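/- Let $F$ be a field of characteristic $2$, let $n\ge 3$, and let $X$ be the set of all involutions (elements of order exactly $2$) in $\mathrm{GL}_n(F)$. Let $\Gamma(\mathrm{GL}_n(F),X)$ be the commuting graph of $\mathrm{GL}_n(F)$ on $X$, i.e. the graph with vertex set $X$ in which two distinct elements $x,y\in X$ are joined by an edge if and only if $xy=yx$. Then $\Gamma(\mathrm{GL}_n(F),X)$ is connected, and its diameter (the maximum, over all pairs of vertices, of the number of edges in a shortest path joining them) is exactly $3$. -/

import Mathlib

/-- The commuting graph of a group `G` on a subset `X`: its vertices are the elements of `X`, and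
two distinct elements are adjacent when they commute in `G`. -/
def commutingGraph (G : Type*) [Group G] (X : Set G) : SimpleGraph X where
  Adj x y := x ≠ y ∧ (x : G) * (y : G) = (y : G) * (x : G)
  symm := ⟨fun _ _ h => ⟨h.1.symm, h.2.symm⟩⟩
  loopless := ⟨fun _ h => h.1 rfl⟩

/-- The set of all involutions (elements of order exactly two) of a group. -/
def involutions (G : Type*) [Group G] : Set G :=
  {x | orderOf x = 2}

open Module Polynomial

section Involutions

variable {A : Type*} [Ring A] [CharP A 2]

/-! In characteristic 2, `x ↦ x - 1` turns involutions into nonzero square-zero elements and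
respects commuting, so the problem is about square-zero operators. Upper bound: two of them are
linked through two rank-one operators, whose images and kernels can be chosen compatibly because a
square-zero operator has rank at most `n / 2`. Lower bound: two opposite shifts on `E × E × K`, with
`E = F[t]` reduced, `t` a unit and `dim K ≤ 1`, have a common centralizer consisting of elements of
`E` and `End K` acting diagonally. It is reduced, so the two involutions have no common neighbour.
-/

theorem mem_involutions_units_iff {x : Aˣ} :
    x ∈ involutions Aˣ ↔ ((x : A) - 1) * ((x : A) - 1) = 0 ∧ (x : A) - 1 ≠ 0 := by
  have hsq : ((x : A) - 1) * ((x : A) - 1) = (x : A) ^ 2 - 1 := by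
    have h1 : (1 : A) + 1 = 0 := CharTwo.add_self_eq_zero 1
    have hx : (x : A) + x = 0 := CharTwo.add_self_eq_zero _
    calc ((x : A) - 1) * ((x : A) - 1) = (x : A) ^ 2 - 1 - ((x : A) + x) + (1 + 1) := by noncomm_ring
      _ = (x : A) ^ 2 - 1 := by rw [h1, hx]; simp
  have : Fact (Nat.Prime 2) := ⟨Nat.prime_two⟩
  rw [involutions, Set.mem_ofPred_eq, orderOf_eq_prime_iff, hsq, sub_eq_zero, sub_ne_zero]
  rw [← Units.val_pow_eq_pow_val, Units.val_eq_one, Ne, Ne, Units.val_eq_one]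

theorem exists_involution_of_mul_self_eq_zero {a : A} (ha : a * a = 0) (ha0 : a ≠ 0) :
    ∃ x : involutions Aˣ, ((x : Aˣ) : A) = 1 + a := by
  have h : (1 + a) * (1 + a) = 1 := by
    have : a + a = 0 := CharTwo.add_self_eq_zero a
    calc (1 + a) * (1 + a) = 1 + (a + a) + a * a := by noncomm_ring
      _ = 1 := by rw [this, ha]; simp
  refine ⟨⟨⟨1 + a, 1 + a, h, h⟩, mem_involutions_units_iff.2 ?_⟩, rfl⟩
  simpa using ⟨ha, ha0⟩

theorem commutingGraph_edist_le_one {G : Type*} [Group G] {X : Set G} {x y : X}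
    (h : (x : G) * y = y * x) : (commutingGraph G X).edist x y ≤ 1 := by
  rw [SimpleGraph.edist_le_one_iff_adj_or_eq]
  by_cases hxy : x = y
  · exact Or.inr hxy
  · exact Or.inl ⟨hxy, h⟩

theorem edist_involutions_le_three
    (H : ∀ a b : A, a * a = 0 → b * b = 0 → a ≠ 0 → b ≠ 0 → ∃ c d : A, c * c = 0 ∧ d * d = 0 ∧
      c ≠ 0 ∧ d ≠ 0 ∧ Commute a c ∧ Commute c d ∧ Commute d b) (x y : involutions Aˣ) :
    (commutingGraph Aˣ (involutions Aˣ)).edist x y ≤ 3 := by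
  obtain ⟨hx, hx0⟩ := mem_involutions_units_iff.1 x.2
  obtain ⟨hy, hy0⟩ := mem_involutions_units_iff.1 y.2
  obtain ⟨c, d, hc, hd, hc0, hd0, hac, hcd, hdb⟩ := H _ _ hx hy hx0 hy0
  obtain ⟨z, hz⟩ := exists_involution_of_mul_self_eq_zero hc hc0
  obtain ⟨w, hw⟩ := exists_involution_of_mul_self_eq_zero hd hd0
  have h1 : Commute ((x : Aˣ) : A) (z : Aˣ) := by
    rw [hz]
    simpa [add_comm] using (hac.add_left (Commute.one_left c)).add_right
      (Commute.one_right ((x : Aˣ) - 1 + 1 : A))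
  have h2 : Commute ((z : Aˣ) : A) (w : Aˣ) := by
    rw [hz, hw]
    exact ((Commute.one_left _).add_left ((Commute.one_right c).add_right hcd))
  have h3 : Commute ((w : Aˣ) : A) (y : Aˣ) := by
    rw [hw]
    simpa [add_comm] using (hdb.add_right (Commute.one_right d)).add_left
      (Commute.one_left ((y : Aˣ) - 1 + 1 : A))
  calc _ ≤ _ := SimpleGraph.edist_triangle (v := z)
    _ ≤ 1 + (1 + 1) := by
      gcongr
      · exact commutingGraph_edist_le_one (Units.ext h1)
      · refine SimpleGraph.edist_triangle (v := w) |>.trans ?_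
        gcongr
        · exact commutingGraph_edist_le_one (Units.ext h2)
        · exact commutingGraph_edist_le_one (Units.ext h3)
    _ = 3 := by norm_num

theorem exists_two_lt_edist_involutions {a b : A} (ha : a * a = 0) (hb : b * b = 0)
    (ha0 : a ≠ 0) (hb0 : b ≠ 0)
    (H : ∀ c : A, c * c = 0 → Commute a c → Commute b c → c = 0) :
    ∃ x y : involutions Aˣ, 2 < (commutingGraph Aˣ (involutions Aˣ)).edist x y := by
  obtain ⟨x, hx⟩ := exists_involution_of_mul_self_eq_zero ha ha0
  obtain ⟨y, hy⟩ := exists_involution_of_mul_self_eq_zero hb hb0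
  have key : ∀ z : involutions Aˣ, (x : Aˣ) * z = z * x → (y : Aˣ) * z = z * y → False := by
    intro z hxz hyz
    obtain ⟨hz, hz0⟩ := mem_involutions_units_iff.1 z.2
    have h1 : Commute ((x : Aˣ) : A) (z : Aˣ) := congrArg Units.val hxz
    have h2 : Commute ((y : Aˣ) : A) (z : Aˣ) := congrArg Units.val hyz
    refine hz0 (H _ hz ?_ ?_)
    · simpa [hx] using (h1.sub_left (Commute.one_left _)).sub_right (Commute.one_right _)
    · simpa [hy] using (h2.sub_left (Commute.one_left _)).sub_right (Commute.one_right _)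
  -- Taking `z = x` in `key` also excludes distances 0 and 1.
  refine ⟨x, y, SimpleGraph.two_lt_edist_iff.2 ⟨?_, ?_, ?_⟩⟩
  · rintro rfl
    exact key x rfl rfl
  · exact fun h => key x rfl h.2.symm
  · ext z
    simp only [SimpleGraph.mem_commonNeighbors, Set.mem_empty_iff_false, iff_false]
    exact fun h => key z h.1.2 h.2.2

end Involutions

/-! ### Upper bound: rank-one square-zero operators -/

section SquareZero

variable {F V : Type*} [Field F] [AddCommGroup V] [Module F V]

theorem finrank_range_le_of_mul_self_eq_zero [FiniteDimensional F V] {a : End F V}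
    (ha : a * a = 0) : 2 * finrank F (LinearMap.range a) ≤ finrank F V := by
  have h := LinearMap.finrank_range_add_finrank_ker a
  have : LinearMap.range a ≤ LinearMap.ker a := by
    rintro _ ⟨v, rfl⟩
    exact LinearMap.congr_fun ha v
  have := Submodule.finrank_mono this
  omega

/-- The range of `a` and one further line span dimension at most `n / 2 + 1 < n`; this is where `n ≥
3` enters. -/
theorem exists_dual_comp_eq_zero [FiniteDimensional F V] (hV : 3 ≤ finrank F V) {a : End F V}
    (ha : a * a = 0) (w : V) : ∃ f : Dual F V, f ≠ 0 ∧ (∀ v, f (a v) = 0) ∧ f w = 0 := by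
  have hlt : LinearMap.range a ⊔ F ∙ w < ⊤ := by
    refine Submodule.lt_top_of_finrank_lt_finrank ?_
    have h1 := Submodule.finrank_add_le_finrank_add_finrank (LinearMap.range a) (F ∙ w)
    have h2 := finrank_range_le_of_mul_self_eq_zero ha
    have h3 : finrank F (F ∙ w) ≤ 1 := by
      simpa using finrank_span_le_card (R := F) ({w} : Set V)
    omega
  obtain ⟨f, hf, hle⟩ := Submodule.exists_le_ker_of_lt_top _ hlt
  exact ⟨f, hf, fun v => hle (Submodule.mem_sup_left ⟨v, rfl⟩),
    hle (Submodule.mem_sup_right (Submodule.mem_span_singleton_self w))⟩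

theorem exists_commuting_chain [FiniteDimensional F V] (hV : 3 ≤ finrank F V) (a b : End F V)
    (ha : a * a = 0) (hb : b * b = 0) (ha0 : a ≠ 0) (hb0 : b ≠ 0) :
    ∃ c d : End F V, c * c = 0 ∧ d * d = 0 ∧ c ≠ 0 ∧ d ≠ 0 ∧
      Commute a c ∧ Commute c d ∧ Commute d b := by
  obtain ⟨v, hv⟩ := DFunLike.ne_iff.1 ha0
  obtain ⟨w, hw⟩ := DFunLike.ne_iff.1 hb0
  obtain ⟨f, hf, hfa, hfw⟩ := exists_dual_comp_eq_zero hV ha (b w)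
  obtain ⟨g, hg, hgb, hgv⟩ := exists_dual_comp_eq_zero hV hb (a v)
  have haa : ∀ u, a (a u) = 0 := LinearMap.congr_fun ha
  have hbb : ∀ u, b (b u) = 0 := LinearMap.congr_fun hb
  -- With `c = f ⊗ a v` and `d = g ⊗ b w`, each required commutation holds because both products
  -- vanish.
  refine ⟨f.smulRight (a v), g.smulRight (b w), ?_, ?_, ?_, ?_, ?_, ?_, ?_⟩
  · ext u; simp [hfa]
  · ext u; simp [hgb]
  · obtain ⟨u, hu⟩ := DFunLike.ne_iff.1 hf
    exact fun h => smul_ne_zero hu hv (LinearMap.congr_fun h u)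
  · obtain ⟨u, hu⟩ := DFunLike.ne_iff.1 hg
    exact fun h => smul_ne_zero hu hw (LinearMap.congr_fun h u)
  · ext u; simp [hfa, haa]
  · ext u; simp [hfw, hgv]
  · ext u; simp [hgb, hbb]

end SquareZero

/-! ### Lower bound: a pair with reduced common centralizer -/

section Reduced

variable {F E K : Type*} [Field F] [CommRing E] [Algebra F E] [AddCommGroup K] [Module F K]

theorem apply_eq_mul_apply_one {t : E} (ht : Algebra.adjoin F {t} = ⊤) (P : End F E)
    (hP : ∀ u, P (t * u) = t * P u) (u : E) : P u = u * P 1 := by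
  have h : ∀ s ∈ Algebra.adjoin F {t}, ∀ u, P (s * u) = s * P u := by
    intro s hs
    induction hs using Algebra.adjoin_induction with
    | mem s hs => rw [Set.mem_singleton_iff.1 hs]; exact hP
    | algebraMap r => intro u; simp [← Algebra.smul_def]
    | add x y _ _ hx hy => intro u; simp [add_mul, hx, hy]
    | mul x y _ _ hx hy => intro u; rw [mul_assoc, hx, hy, mul_assoc]
  simpa using h u (ht ▸ Algebra.mem_top) 1

/-- The square-zero operator `(u, v, k) ↦ (v, 0, 0)`. -/
def upperShift (F E K : Type*) [Field F] [CommRing E] [Algebra F E] [AddCommGroup K] [Module F K] :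
    End F ((E × E) × K) :=
  LinearMap.inl F (E × E) K ∘ₗ LinearMap.inl F E E ∘ₗ LinearMap.snd F E E ∘ₗ
    LinearMap.fst F (E × E) K

/-- The square-zero operator `(u, v, k) ↦ (0, t * u, 0)`. -/
def lowerShift (F K : Type*) {E : Type*} [Field F] [CommRing E] [Algebra F E] [AddCommGroup K]
    [Module F K] (t : E) : End F ((E × E) × K) :=
  LinearMap.inl F (E × E) K ∘ₗ LinearMap.inr F E E ∘ₗ LinearMap.mulLeft F t ∘ₗ
    LinearMap.fst F E E ∘ₗ LinearMap.fst F (E × E) K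

@[simp]
theorem upperShift_apply (p : (E × E) × K) : upperShift F E K p = ((p.1.2, 0), 0) := rfl

@[simp]
theorem lowerShift_apply (t : E) (p : (E × E) × K) :
    lowerShift F K t p = ((0, t * p.1.1), 0) := rfl

/-- The shifts force `c` to be `diag(P, P, R)` with `P` commuting with `t`, hence multiplication by
`P 1`. Then `c * c = 0` gives `P 1 * P 1 = 0` and `R * R = 0`. -/
theorem eq_zero_of_commute_shifts [IsReduced E] {t : E} (ht : Algebra.adjoin F {t} = ⊤)
    (htu : IsUnit t) (hK : ∀ R : End F K, R * R = 0 → R = 0) {c : End F ((E × E) × K)}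
    (hc : c * c = 0) (hac : Commute (upperShift F E K) c) (hbc : Commute (lowerShift F K t) c) :
    c = 0 := by
  have ha : ∀ p, c ((p.1.2, 0), 0) = (((c p).1.2, 0), 0) := fun p =>
    (LinearMap.congr_fun hac.eq p).symm
  have hb : ∀ p, c ((0, t * p.1.1), 0) = ((0, t * (c p).1.1), 0) := fun p =>
    (LinearMap.congr_fun hbc.eq p).symm
  have hcc : ∀ p, c (c p) = 0 := LinearMap.congr_fun hc
  let P : End F E := LinearMap.fst F E E ∘ₗ LinearMap.fst F (E × E) K ∘ₗ c ∘ₗ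
    LinearMap.inl F (E × E) K ∘ₗ LinearMap.inl F E E
  let R : End F K := LinearMap.snd F (E × E) K ∘ₗ c ∘ₗ LinearMap.inr F (E × E) K
  have hPdef : ∀ u, P u = (c ((u, 0), 0)).1.1 := fun _ => rfl
  have hRdef : ∀ k, R k = (c (0, k)).2 := fun _ => rfl
  have h1 : ∀ u, c ((u, 0), 0) = ((P u, 0), 0) := fun u => by
    have := ha ((0, u), 0)
    rw [hPdef, this]
  have h2 : ∀ u, c ((0, t * u), 0) = ((0, t * P u), 0) := fun u => hb ((u, 0), 0)
  have h3 : ∀ u, P (t * u) = t * P u := fun u => by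
    have := ha ((0, t * u), 0)
    rw [h2, h1] at this
    simpa using this
  have hP := apply_eq_mul_apply_one ht P h3
  have hP1 : P 1 = 0 := by
    have := hcc ((1, 0), 0)
    rw [h1, h1, hP (P 1)] at this
    exact (IsNilpotent.eq_zero ⟨2, by simpa [sq] using this⟩)
  have hP0 : ∀ u, P u = 0 := fun u => by rw [hP, hP1, mul_zero]
  have h4 : ∀ k, c (0, k) = (0, R k) := fun k => by
    have e1 := ha (0, k)
    have e2 := hb (0, k)
    simp only [Prod.fst_zero, Prod.snd_zero, mul_zero] at e1 e2
    have z : c ((0, 0), 0) = 0 := map_zero c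
    rw [z] at e1 e2
    have f1 : (c (0, k)).1.2 = 0 := by simpa using (congrArg (fun p => p.1.1) e1).symm
    have f2 : (c (0, k)).1.1 = 0 := by
      have : t * (c (0, k)).1.1 = 0 := by simpa using (congrArg (fun p => p.1.2) e2).symm
      exact htu.mul_right_eq_zero.1 this
    exact Prod.ext (Prod.ext f2 f1) rfl
  have hR : R = 0 := hK R <| LinearMap.ext fun k => by
    have := hcc (0, k)
    rw [h4, h4] at this
    exact congrArg Prod.snd this
  obtain ⟨s, hs⟩ := htu.exists_right_inv
  refine LinearMap.ext fun p => ?_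
  obtain ⟨⟨u, v⟩, k⟩ := p
  have hv : t * (s * v) = v := by rw [← mul_assoc, hs, one_mul]
  have e : (((u, v), k) : (E × E) × K) = ((u, 0), 0) + ((0, t * (s * v)), 0) + (0, k) := by
    simp [hv]
  rw [e, map_add, map_add, h1, h2, h4, hP0, hP0, hR]
  simp

end Reduced

/-- `X ^ m + 1` for odd `m` and `X ^ m + X ^ (m - 1) + 1` for even `m` work over every such field:
the derivative is a power of `X`, coprime to `X * g + 1`. Separability makes `F[X]/(f)` reduced;
constant term 1 makes the root a unit. -/
theorem exists_monic_separable_eval_zero_eq_one (F : Type*) [Field F] [CharP F 2] (m : ℕ)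
    (hm : 0 < m) : ∃ f g : F[X], f.Monic ∧ f.natDegree = m ∧ f.Separable ∧ f = X * g + 1 := by
  have h2 : (1 : F[X]) + 1 = 0 := CharTwo.add_self_eq_zero 1
  have sep : ∀ g : F[X], ∀ k, derivative (X * g + 1) = X ^ k → (X * g + 1).Separable := by
    intro g k h
    rw [Polynomial.Separable, h]
    exact IsCoprime.pow_right ⟨1, -g, by ring⟩
  rcases Nat.even_or_odd' m with ⟨j, rfl | rfl⟩
  · obtain ⟨i, rfl⟩ : ∃ i, j = i + 1 := ⟨j - 1, by omega⟩
    refine ⟨_, X ^ (2 * i + 1) + X ^ (2 * i), ?_, ?_, sep _ (2 * i) ?_, rfl⟩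
    · have : (X * (X ^ (2 * i + 1) + X ^ (2 * i)) + 1 : F[X]) =
        X ^ (2 * i + 2) + (X ^ (2 * i + 1) + 1) := by ring
      rw [this]
      exact monic_X_pow_add (by
        rw [← C_1, degree_X_pow_add_C (by omega)]
        exact_mod_cast Nat.lt_succ_self _)
    · rw [show 2 * (i + 1) = 2 * i + 1 + 1 by ring, mul_add, ← pow_succ', ← pow_succ']
      compute_degree!
    · have e : (X * (X ^ (2 * i + 1) + X ^ (2 * i)) + 1 : F[X]) =
        X ^ (2 * i + 2) + X ^ (2 * i + 1) + 1 := by ring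
      rw [e, derivative_add, derivative_add, derivative_X_pow, derivative_X_pow, derivative_one]
      push_cast
      simp only [map_add, map_mul, map_natCast, map_one, C_ofNat]
      linear_combination (((i : F[X]) + 1) * X ^ (2 * i + 1) + (i : F[X]) * X ^ (2 * i)) * h2
  · refine ⟨_, X ^ (2 * j), ?_, ?_, sep _ (2 * j) ?_, rfl⟩
    · rw [← pow_succ']
      exact monic_X_pow_add (by compute_degree!)
    · rw [← pow_succ']
      compute_degree!
    · rw [← pow_succ', derivative_add, derivative_X_pow, derivative_one]
      push_cast
      simp only [map_add, map_mul, map_natCast, map_one, C_ofNat]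
      linear_combination (j : F[X]) * X ^ (2 * j) * h2

theorem isReduced_adjoinRoot_of_separable {F : Type*} [Field F] {f : F[X]} (hf : f.Separable) :
    IsReduced (AdjoinRoot f) :=
  (Ideal.isRadical_iff_quotient_reduced _).1
    (isRadical_iff_span_singleton.1 hf.squarefree.isRadical)

/-- The algebra `A` contains two square-zero elements whose common centralizer contains
no square-zero element but `0`. -/
def HasReducedSquareZeroPair (A : Type*) [Ring A] : Prop :=
  ∃ a b : A, a * a = 0 ∧ b * b = 0 ∧ a ≠ 0 ∧ b ≠ 0 ∧
    ∀ c : A, c * c = 0 → Commute a c → Commute b c → c = 0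

theorem HasReducedSquareZeroPair.of_ringEquiv {A B : Type*} [Ring A] [Ring B] (e : A ≃+* B)
    (h : HasReducedSquareZeroPair A) : HasReducedSquareZeroPair B := by
  obtain ⟨a, b, ha, hb, ha0, hb0, H⟩ := h
  refine ⟨e a, e b, by simp [← map_mul, ha], by simp [← map_mul, hb], by simpa using ha0,
    by simpa using hb0, fun c hc hac hbc => ?_⟩
  have := H (e.symm c) (by simp [← map_mul, hc])
    (by simpa using hac.map e.symm) (by simpa using hbc.map e.symm)
  simpa using this

theorem hasReducedSquareZeroPair_matrix_of_complement (F K : Type*) [Field F] [CharP F 2]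
    [AddCommGroup K] [Module F K] [FiniteDimensional F K]
    (hK : ∀ R : End F K, R * R = 0 → R = 0) {n m : ℕ} (hm : 0 < m)
    (hn : n = m + m + finrank F K) : HasReducedSquareZeroPair (Matrix (Fin n) (Fin n) F) := by
  obtain ⟨f, g, hf, hdeg, hsep, hfg⟩ := exists_monic_separable_eval_zero_eq_one F m hm
  have := isReduced_adjoinRoot_of_separable hsep
  let pb := AdjoinRoot.powerBasis' hf
  have := pb.finite
  have hE : finrank F (AdjoinRoot f) = m := by
    rw [pb.finrank, AdjoinRoot.powerBasis'_dim, hdeg]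
  have : Nontrivial (AdjoinRoot f) := nontrivial_of_finrank_pos (R := F) (by omega)
  have htu : IsUnit (AdjoinRoot.root f) := by
    refine IsUnit.of_mul_eq_one (-(AdjoinRoot.mk f g)) ?_
    have : AdjoinRoot.mk f (X * g + 1) = 0 := by rw [← hfg, AdjoinRoot.mk_self]
    rw [map_add, map_mul, AdjoinRoot.mk_X, map_one] at this
    linear_combination -this
  have hV : finrank F ((AdjoinRoot f × AdjoinRoot f) × K) = n := by
    rw [finrank_prod, finrank_prod, hE, hn]
  refine HasReducedSquareZeroPair.of_ringEquiv
    (algEquivMatrix (finBasisOfFinrankEq F _ hV)).toRingEquiv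
    ⟨upperShift F (AdjoinRoot f) K, lowerShift F K (AdjoinRoot.root f), ?_, ?_, ?_, ?_,
      fun c hc hac hbc => eq_zero_of_commute_shifts AdjoinRoot.adjoinRoot_eq_top htu hK hc hac hbc⟩
  · ext <;> simp
  · ext <;> simp
  · intro h
    simpa using LinearMap.congr_fun h ((0, 1), 0)
  · intro h
    have := LinearMap.congr_fun h ((1, 0), 0)
    simp at this
    exact htu.ne_zero this

theorem hasReducedSquareZeroPair_matrix (F : Type*) [Field F] [CharP F 2] {n : ℕ} (hn : 2 ≤ n) :
    HasReducedSquareZeroPair (Matrix (Fin n) (Fin n) F) := by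
  -- `K` absorbs the parity of `n`: zero, or a line, whose endomorphisms are scalars.
  rcases Nat.even_or_odd' n with ⟨m, rfl | rfl⟩
  · exact hasReducedSquareZeroPair_matrix_of_complement F PUnit.{1}
      (fun R _ => Subsingleton.elim _ _) (m := m) (by omega) (by simp [two_mul, finrank_zero_of_subsingleton])
  · refine hasReducedSquareZeroPair_matrix_of_complement F F (fun R hR => ?_) (m := m) (by omega)
      (by simp [two_mul])
    have h : R (R 1 • 1) = 0 := by simpa using LinearMap.congr_fun hR 1
    rw [map_smul, smul_eq_mul, mul_self_eq_zero] at h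
    exact LinearMap.ext_ring h

theorem corollary2p9 (F : Type*) [Field F] [CharP F 2] (n : ℕ) (hn : 3 ≤ n) :
    (commutingGraph (Matrix.GeneralLinearGroup (Fin n) F)
        (involutions (Matrix.GeneralLinearGroup (Fin n) F))).Connected ∧
      (commutingGraph (Matrix.GeneralLinearGroup (Fin n) F)
        (involutions (Matrix.GeneralLinearGroup (Fin n) F))).ediam = 3 := by
  have : Nonempty (Fin n) := ⟨⟨0, by omega⟩⟩
  obtain ⟨a, b, ha, hb, ha0, hb0, H⟩ := hasReducedSquareZeroPair_matrix F (n := n) (by omega)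
  obtain ⟨x, y, hxy⟩ := exists_two_lt_edist_involutions ha hb ha0 hb0 H
  have hle : (commutingGraph (Matrix.GeneralLinearGroup (Fin n) F)
      (involutions (Matrix.GeneralLinearGroup (Fin n) F))).ediam ≤ 3 := by
    refine SimpleGraph.ediam_le_of_edist_le (edist_involutions_le_three ?_)
    intro a b ha hb ha0 hb0
    let e : End F (Fin n → F) ≃ₐ[F] Matrix (Fin n) (Fin n) F := algEquivMatrix'
    obtain ⟨c, d, hc, hd, hc0, hd0, hac, hcd, hdb⟩ := exists_commuting_chain (by simpa using hn)
      (e.symm a) (e.symm b) (by rw [← map_mul, ha, map_zero]) (by rw [← map_mul, hb, map_zero])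
      (by simpa using ha0) (by simpa using hb0)
    exact ⟨e c, e d, by rw [← map_mul, hc, map_zero], by rw [← map_mul, hd, map_zero],
      by simpa using hc0, by simpa using hd0, by simpa using hac.map e, hcd.map e,
      by simpa using hdb.map e⟩
  have : Nonempty (involutions (Matrix.GeneralLinearGroup (Fin n) F)) := ⟨x⟩
  refine ⟨SimpleGraph.connected_of_ediam_ne_top (ne_top_of_le_ne_top (by simp) hle),
    le_antisymm hle ?_⟩
  have h3 : (3 : ℕ∞) = 2 + 1 := by norm_num
  rw [h3]
  exact Order.add_one_le_of_lt (hxy.trans_le SimpleGraph.edist_le_ediam)
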